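/- Let $\mathbf K\subset\mathbb E^2$ be a compact convex set with nonempty interior. For points $P\neq Q$ in its interior, let the line $PQ$ meet $\partial\mathbf K$ at $A$ and $B$, in the order $A,P,Q,B$. The Hilbert distance is $$h(P,Q)=\tfrac12\log\Big(\frac{AQ}{AP}\cdot\frac{BP}{BQ}\Big),\qquad h(P,P)=0.$$ Let $K$ be a convex body (a nonempty compact convex set) contained in the interior of $\mathbf K$. Its Hilbert perimeter $\mathcal P$ is the Hilbert length of its boundary, that is, the supremum of the sums $\sum_i h(p_i,p_{i+1})$ (indices taken cyclically) over all convex polygons with vertices $p_0,\dots,p_n\in\partial K$ in counterclockwise order. One-gons and two-gons are allowed, so a segment counts twice. For each $\varphi\in[0,2\pi]$ let $\ell(\varphi)$ be the support line of $\mathbf K$ with outer normal $(\cos\varphi,\sin\varphi)$, and let $R(\varphi)$ be a point of $\ell(\varphi)\cap\mathbf K$, chosen arbitrarily if there is more than one. For $X\in K$, consider the counterclockwise angle in $(0,\pi)$ from the ray of $\ell(\varphi)$ that starts at $R(\varphi)$ in the direction $(-\sin\varphi,\cos\varphi)$ to the ray from $R(\varphi)$ through $X$. Let $\psi_1(\varphi)$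 and $\psi_2(\varphi)$ be the smallest and the largest of these angles as $X$ ranges over $K$. **Theorem 3.2.** The function $\cot\psi_1-\cot\psi_2$ is integrable on $[0,2\pi]$, and $$\mathcal P=\frac12\int_0^{2\pi}\big(\cot\psi_1(\varphi)-\cot\psi_2(\varphi)\big)\,d\varphi .$$ -/

import Mathlib

noncomputable section

namespace HilbertPlane

/-- The Euclidean plane. -/
abbrev Plane : Type := EuclideanSpace ℝ (Fin 2)

/-- The far endpoint of the chord of `C` through `P` and `Q`, on the side of `Q`
(for `P ≠ Q` in the interior of the compact convex set `C`): the last point of `C` on the line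
`PQ`, directed from `P` to `Q`. -/
def chordEnd (C : Set Plane) (P Q : Plane) : Plane :=
  AffineMap.lineMap P Q (sSup {t : ℝ | AffineMap.lineMap P Q t ∈ C})

open Classical in
/-- The Hilbert distance `h(P, Q) = ½ log ((AQ / AP) (BP / BQ))` of two points in the interior of
the compact convex set `C`, where the line `PQ` strikes the boundary of `C` at `A` and `B`, in the
order `A P Q B`; and `h(P, P) = 0`. -/
def hilbertDist (C : Set Plane) (P Q : Plane) : ℝ :=
  if P = Q then 0
  else
    let A := chordEnd C Q P
    let B := chordEnd C P Q
    1 / 2 * Real.log ((dist A Q / dist A P) * (dist B P / dist B Q))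

/-- Positivity says that `X, Y, Z` are the vertices of a nondegenerate triangle in counterclockwise
order: twice the signed area of `XYZ`. -/
def signedArea (X Y Z : Plane) : ℝ :=
  (Y 0 - X 0) * (Z 1 - X 1) - (Y 1 - X 1) * (Z 0 - X 0)

/-- `p 0, …, p n` are, in counterclockwise order, the vertices of a convex polygon inscribed in the
boundary of `K`. For three or more vertices they are in strictly convex position. One-gons and
two-gons are allowed. -/
def IsInscribedPolygon (K : Set Plane) {n : ℕ} (p : Fin (n + 1) → Plane) : Prop :=
  (∀ i, p i ∈ frontier K) ∧ ∀ i j k, i < j → j < k → 0 < signedArea (p i) (p j) (p k)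

/-- The Hilbert length of the closed polygon `p 0, …, p n, p 0`; the index `i + 1` is cyclic. -/
def polygonLength (C : Set Plane) {n : ℕ} (p : Fin (n + 1) → Plane) : ℝ :=
  ∑ i, hilbertDist C (p i) (p (i + 1))

/-- The Hilbert perimeter of `K`, i.e. the Hilbert length of its boundary curve: the supremum, in
the extended reals, of the Hilbert lengths of the convex polygons inscribed in the boundary.
(Collinear vertices need not be considered: `hilbertDist` is additive along segments.
For a segment, this is the length of the two-gon, twice the distance of the endpoints.) -/
def hilbertPerimeter (C K : Set Plane) : EReal :=
  ⨆ (n : ℕ) (p : Fin (n + 1) → Plane) (_ : IsInscribedPolygon K p), (polygonLength C p : EReal)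

/-- The outer unit normal `N(φ) = (cos φ, sin φ)`. -/
def normal (φ : ℝ) : Plane := !₂[Real.cos φ, Real.sin φ]

/-- The positive (counterclockwise) unit direction `(-sin φ, cos φ)` of the support line. -/
def tangent (φ : ℝ) : Plane := !₂[-Real.sin φ, Real.cos φ]

/-- `R` is a point of `C` on the support line of `C` with outer normal `N(φ)`. -/
def IsSupportPoint (C : Set Plane) (φ : ℝ) (R : Plane) : Prop :=
  R ∈ C ∧ ∀ X ∈ C, inner ℝ (normal φ) X ≤ inner ℝ (normal φ) R

/-- The set of the angles `∠ S R X`, `X ∈ K`, where `S = R + tangent φ` is on the positive side of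
`R` on the line through `R` with normal `N(φ)`. For `X` in the open half plane
`⟪N(φ), X⟫ < ⟪N(φ), R⟫` this unoriented angle is the counterclockwise angle, in `(0, π)`, from the
ray `RS` to the ray `RX`. -/
def subtendedAngles (K : Set Plane) (φ : ℝ) (R : Plane) : Set ℝ :=
  (fun X => EuclideanGeometry.angle (R + tangent φ) R X) '' K

/-- The smaller extreme angle subtended by `K` at `R`. -/
def psi₁ (K : Set Plane) (φ : ℝ) (R : Plane) : ℝ := sInf (subtendedAngles K φ R)

/-- The larger extreme angle subtended by `K` at `R`. -/
def psi₂ (K : Set Plane) (φ : ℝ) (R : Plane) : ℝ := sSup (subtendedAngles K φ R)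

end HilbertPlane

end

noncomputable section

open MeasureTheory Set Filter Topology

namespace HilbertPlane

variable {C : Set Plane}

/-! The support function s of `C` is Lipschitz, hence differentiable almost everywhere, and where it
is, s'(φ) is the tangential coordinate of every point of contact R. So the cotangent of the angle at
R towards X is minus the derivative of log d, where d(φ) is the distance of X from the support line.
Since log d is absolutely continuous, the cotangent integrates to a logarithm of a ratio of
distances.

For two points P, Q the difference of the cotangents has the sign of the orientation of P, Q, R, so
it changes sign only when R passes an end A or B of the chord PQ. On each of the two arcs the
integral of its absolute value is the logarithm of a product of ratios of distances from the support
lines at A and B. By similar triangles these ratios are AQ/AP and BP/BQ. Hence four times the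
Hilbert distance is the integral of |cot P - cot Q| over all support lines (`four_mul_hilbertDist`),
a formula of Crofton type.

Around a convex polygon the cotangent rises and falls at most once, because a line does not separate
the diagonals of a convex quadrilateral. So the cyclic sum of absolute differences is twice the
oscillation over the vertices, hence at most twice the oscillation over `K`
(`sum_abs_cotAngle_sub_le`, `two_mul_cotAngle_sub_le_sum`). Integration bounds the perimeter from
above. Inscribed polygons whose oscillation is close to that of `K`, uniformly in φ
(`exists_isInscribedPolygon_approx`), give equality. -/

theorem inner_normal (φ : ℝ) (X : Plane) :
    inner ℝ (normal φ) X = Real.cos φ * X 0 + Real.sin φ * X 1 := by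
  simp [normal, PiLp.inner_apply, Fin.sum_univ_two, mul_comm]

theorem inner_tangent (φ : ℝ) (X : Plane) :
    inner ℝ (tangent φ) X = -Real.sin φ * X 0 + Real.cos φ * X 1 := by
  simp [tangent, PiLp.inner_apply, Fin.sum_univ_two, mul_comm]

theorem norm_normal (φ : ℝ) : ‖normal φ‖ = 1 := by
  simp [normal, EuclideanSpace.norm_eq, Fin.sum_univ_two]

theorem norm_tangent (φ : ℝ) : ‖tangent φ‖ = 1 := by
  simp [tangent, EuclideanSpace.norm_eq, Fin.sum_univ_two]

theorem abs_inner_normal_le (φ : ℝ) (X : Plane) : |inner ℝ (normal φ) X| ≤ ‖X‖ := by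
  simpa [norm_normal] using abs_real_inner_le_norm (normal φ) X

theorem abs_inner_tangent_le (φ : ℝ) (X : Plane) : |inner ℝ (tangent φ) X| ≤ ‖X‖ := by
  simpa [norm_tangent] using abs_real_inner_le_norm (tangent φ) X

theorem hasDerivAt_inner_normal (φ : ℝ) (X : Plane) :
    HasDerivAt (fun θ => inner ℝ (normal θ) X) (inner ℝ (tangent φ) X) φ := by
  simp only [inner_normal, inner_tangent]
  exact ((Real.hasDerivAt_cos φ).mul_const _).add ((Real.hasDerivAt_sin φ).mul_const _)

theorem abs_inner_normal_sub_le (φ θ : ℝ) (X : Plane) :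
    |inner ℝ (normal φ) X - inner ℝ (normal θ) X| ≤ ‖X‖ * |φ - θ| := by
  have := Convex.norm_image_sub_le_of_norm_hasDerivWithin_le (s := univ) (C := ‖X‖)
    (f := fun θ => inner ℝ (normal θ) X) (x := θ) (y := φ)
    (fun x _ => (hasDerivAt_inner_normal x X).hasDerivWithinAt)
    (fun x _ => abs_inner_tangent_le x X) convex_univ (mem_univ _) (mem_univ _)
  simpa using this

/-! ### Support function and points of contact -/

/-- The support function of `C`. -/
def supportFun (C : Set Plane) (φ : ℝ) : ℝ := sSup ((fun X => inner ℝ (normal φ) X) '' C)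

theorem exists_isSupportPoint (hC : IsCompact C) (hne : C.Nonempty) (φ : ℝ) :
    ∃ R, IsSupportPoint C φ R := by
  obtain ⟨R, hR, h⟩ := hC.exists_isMaxOn hne
    (f := fun X => (inner ℝ (normal φ) X : ℝ)) (by fun_prop)
  exact ⟨R, hR, fun X hX => h hX⟩

theorem IsSupportPoint.supportFun_eq {φ : ℝ} {R : Plane} (h : IsSupportPoint C φ R) :
    supportFun C φ = inner ℝ (normal φ) R := by
  refine IsGreatest.csSup_eq ⟨mem_image_of_mem _ h.1, ?_⟩
  rintro _ ⟨X, hX, rfl⟩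
  exact h.2 X hX

theorem inner_le_supportFun (hC : IsCompact C) (φ : ℝ) {X : Plane} (hX : X ∈ C) :
    inner ℝ (normal φ) X ≤ supportFun C φ := by
  obtain ⟨R, hR⟩ := exists_isSupportPoint hC ⟨X, hX⟩ φ
  rw [hR.supportFun_eq]
  exact hR.2 X hX

theorem supportFun_periodic : Function.Periodic (supportFun C) (2 * Real.pi) := by
  intro φ
  simp [supportFun, inner_normal]

theorem exists_lipschitzWith_supportFun (hC : IsCompact C) (hne : C.Nonempty) :
    ∃ M, LipschitzWith M (supportFun C) := by
  obtain ⟨M, hM⟩ := hC.isBounded.exists_norm_le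
  refine ⟨M.toNNReal, LipschitzWith.of_le_add_mul' M fun φ θ => ?_⟩
  obtain ⟨R, hR⟩ := exists_isSupportPoint hC hne φ
  have h1 := inner_le_supportFun hC θ hR.1
  have h2 := abs_le.1 (abs_inner_normal_sub_le φ θ R)
  have h3 := mul_le_mul_of_nonneg_right (hM R hR.1) (abs_nonneg (φ - θ))
  rw [hR.supportFun_eq, Real.dist_eq]
  linarith [h2.2]

/-- The support function dominates `⟪N(θ), R⟫`, with equality at `φ`, so the difference has a
minimum there. In particular the choice of the point of contact is immaterial wherever the
derivative exists. -/
theorem IsSupportPoint.deriv_supportFun (hC : IsCompact C) {φ : ℝ} {R : Plane}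
    (h : IsSupportPoint C φ R) (hd : DifferentiableAt ℝ (supportFun C) φ) :
    deriv (supportFun C) φ = inner ℝ (tangent φ) R := by
  have h1 := hd.hasDerivAt.sub (hasDerivAt_inner_normal φ R)
  have h2 : IsLocalMin (supportFun C - fun θ => inner ℝ (normal θ) R) φ := by
    refine Filter.Eventually.of_forall fun θ => ?_
    simp only [Pi.sub_apply, h.supportFun_eq, sub_self]
    linarith [inner_le_supportFun hC θ h.1]
  linarith [h2.hasDerivAt_eq_zero h1]

/-! ### Distances from support lines and cotangents -/

/-- The distance of `X` from the support line of `C` with outer normal `N(φ)`. -/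
def height (C : Set Plane) (φ : ℝ) (X : Plane) : ℝ := supportFun C φ - inner ℝ (normal φ) X

/-- The cotangent of the angle under which `X` is seen from the point of contact of the support
line with outer normal `N(φ)`, expressed by the support function. -/
def cotAngle (C : Set Plane) (φ : ℝ) (X : Plane) : ℝ :=
  (inner ℝ (tangent φ) X - deriv (supportFun C) φ) / height C φ X

theorem height_periodic (X : Plane) :
    Function.Periodic (fun φ => height C φ X) (2 * Real.pi) := by
  intro φ
  simp only [height, supportFun_periodic φ, inner_normal, Real.cos_add_two_pi,
    Real.sin_add_two_pi]

theorem cotAngle_periodic (X : Plane) :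
    Function.Periodic (fun φ => cotAngle C φ X) (2 * Real.pi) := by
  intro φ
  have h : deriv (supportFun C) (φ + 2 * Real.pi) = deriv (supportFun C) φ := by
    rw [← deriv_comp_add_const]
    congr 1
    exact funext supportFun_periodic
  have h2 := height_periodic (C := C) X φ
  simp only at h2
  simp only [cotAngle, h, h2, inner_tangent, Real.cos_add_two_pi, Real.sin_add_two_pi]

/-- A δ-neighbourhood of `K` still lies in `C`, so `X + δ N(φ)` cannot be beyond the support line.
-/
theorem exists_le_height (hC : IsCompact C) {K : Set Plane} (hK : IsCompact K)
    (hKC : K ⊆ interior C) : ∃ δ > 0, ∀ φ, ∀ X ∈ K, δ ≤ height C φ X := by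
  obtain ⟨δ, hδ, h⟩ := hK.exists_cthickening_subset_open isOpen_interior hKC
  refine ⟨δ, hδ, fun φ X hX => ?_⟩
  have h1 : X + δ • normal φ ∈ C := by
    apply interior_subset
    apply h
    apply Metric.mem_cthickening_of_dist_le _ X _ _ hX
    simp [norm_smul, norm_normal, abs_of_pos hδ]
  have h2 := inner_le_supportFun hC φ h1
  rw [inner_add_right, inner_smul_right, real_inner_self_eq_norm_sq, norm_normal] at h2
  unfold height
  linarith

theorem height_pos (hC : IsCompact C) {X : Plane} (hX : X ∈ interior C) (φ : ℝ) :
    0 < height C φ X := by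
  obtain ⟨δ, hδ, h⟩ := exists_le_height hC (isCompact_singleton (x := X))
    (singleton_subset_iff.2 hX)
  exact hδ.trans_le (h φ X rfl)

theorem exists_lipschitzWith_height (hC : IsCompact C) (hne : C.Nonempty) (X : Plane) :
    ∃ M, LipschitzWith M (fun φ => height C φ X) := by
  obtain ⟨M, hM⟩ := exists_lipschitzWith_supportFun hC hne
  have h : LipschitzWith ‖X‖₊ (fun φ => (inner ℝ (normal φ) X : ℝ)) :=
    LipschitzWith.of_dist_le_mul fun φ θ => by
      simpa [Real.dist_eq] using abs_inner_normal_sub_le φ θ X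
  exact ⟨_, hM.sub h⟩

theorem ae_differentiableAt_supportFun (hC : IsCompact C) (hne : C.Nonempty) :
    ∀ᵐ φ, DifferentiableAt ℝ (supportFun C) φ := by
  obtain ⟨M, hM⟩ := exists_lipschitzWith_supportFun hC hne
  exact hM.ae_differentiableAt

theorem IsSupportPoint.height_eq {φ : ℝ} {R : Plane} (h : IsSupportPoint C φ R) (X : Plane) :
    height C φ X = inner ℝ (normal φ) (R - X) := by
  rw [height, h.supportFun_eq, inner_sub_right]

theorem IsSupportPoint.cotAngle_eq (hC : IsCompact C) {φ : ℝ} {R : Plane}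
    (h : IsSupportPoint C φ R) (hd : DifferentiableAt ℝ (supportFun C) φ) (X : Plane) :
    cotAngle C φ X = inner ℝ (tangent φ) (X - R) / inner ℝ (normal φ) (R - X) := by
  rw [cotAngle, h.height_eq, h.deriv_supportFun hC hd, inner_sub_right (tangent φ)]

/-- The sign of the difference of the cotangents is the orientation of `P`, `Q` and the point of
contact. -/
theorem IsSupportPoint.cotAngle_sub (hC : IsCompact C) {φ : ℝ} {R P Q : Plane}
    (h : IsSupportPoint C φ R) (hd : DifferentiableAt ℝ (supportFun C) φ)
    (hP : P ∈ interior C) (hQ : Q ∈ interior C) :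
    cotAngle C φ P - cotAngle C φ Q =
      signedArea P Q R / (height C φ P * height C φ Q) := by
  have h1 := (height_pos hC hP φ).ne'
  have h2 := (height_pos hC hQ φ).ne'
  have h3 := Real.sin_sq_add_cos_sq φ
  rw [cotAngle, cotAngle, div_sub_div _ _ h1 h2]
  congr 1
  rw [h.height_eq, h.height_eq, h.deriv_supportFun hC hd]
  simp only [inner_normal, inner_tangent, signedArea, PiLp.sub_apply]
  linear_combination ((Q 0 - P 0) * (R 1 - P 1) - (Q 1 - P 1) * (R 0 - P 0)) * h3

theorem height_lineMap (φ t : ℝ) (P Q : Plane) :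
    height C φ (AffineMap.lineMap P Q t) = (1 - t) * height C φ P + t * height C φ Q := by
  simp only [height, AffineMap.lineMap_apply_module, inner_add_right, inner_smul_right]
  ring

theorem IsSupportPoint.height_self {φ : ℝ} {R : Plane} (h : IsSupportPoint C φ R) :
    height C φ R = 0 := by
  rw [height, h.supportFun_eq, sub_self]

/-! ### Integrating the cotangent -/

theorem lipschitzWith_log_of_le {f : ℝ → ℝ} {M : NNReal} (hf : LipschitzWith M f) {δ : ℝ}
    (hδ : 0 < δ) (h : ∀ x, δ ≤ f x) :
    LipschitzWith (M / δ).toNNReal (fun x => Real.log (f x)) := by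
  refine LipschitzWith.of_le_add_mul' _ fun x y => ?_
  have hx := hδ.trans_le (h x)
  have hy := hδ.trans_le (h y)
  have h1 := Real.log_le_sub_one_of_pos (div_pos hx hy)
  rw [Real.log_div hx.ne' hy.ne'] at h1
  have h2 : f x / f y - 1 ≤ M / δ * dist x y := by
    rw [div_sub_one hy.ne', div_mul_eq_mul_div]
    have h3 := (le_abs_self _).trans (hf.dist_le_mul x y)
    exact (div_le_div_of_nonneg_right h3 hy.le).trans
      (div_le_div_of_nonneg_left (by positivity) hδ (h y))
  linarith

section FundamentalTheorem

variable (hC : IsCompact C) {X : Plane} (hX : X ∈ interior C)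
include hC hX

theorem absolutelyContinuous_log_height (a b : ℝ) :
    AbsolutelyContinuousOnInterval (fun φ => Real.log (height C φ X)) a b := by
  obtain ⟨M, hM⟩ := exists_lipschitzWith_height hC ⟨X, interior_subset hX⟩ X
  obtain ⟨δ, hδ, h⟩ := exists_le_height hC (isCompact_singleton (x := X))
    (singleton_subset_iff.2 hX)
  exact ((lipschitzWith_log_of_le hM hδ fun φ => h φ X rfl).lipschitzOnWith
    (s := uIcc a b)).absolutelyContinuousOnInterval

theorem ae_deriv_log_height :
    ∀ᵐ φ, deriv (fun φ => Real.log (height C φ X)) φ = -cotAngle C φ X := by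
  filter_upwards [ae_differentiableAt_supportFun hC ⟨X, interior_subset hX⟩] with φ hd
  have h := (hd.hasDerivAt.sub (hasDerivAt_inner_normal φ X)).log (height_pos hC hX φ).ne'
  have h2 := h.deriv
  rw [cotAngle, ← neg_div, neg_sub]
  exact h2

theorem intervalIntegrable_cotAngle (a b : ℝ) :
    IntervalIntegrable (fun φ => cotAngle C φ X) volume a b := by
  have h := (absolutelyContinuous_log_height hC hX a b).intervalIntegrable_deriv.neg
  refine h.congr_ae (ae_restrict_of_ae ?_)
  filter_upwards [ae_deriv_log_height hC hX] with φ hφ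
  simp [hφ]

theorem integral_cotAngle (a b : ℝ) :
    ∫ φ in a..b, cotAngle C φ X = Real.log (height C a X) - Real.log (height C b X) := by
  have h := (absolutelyContinuous_log_height hC hX a b).integral_deriv_eq_sub
  rw [intervalIntegral.integral_congr_ae (g := fun φ => -cotAngle C φ X)] at h
  · rw [intervalIntegral.integral_neg] at h
    linarith
  · filter_upwards [ae_deriv_log_height hC hX] with φ hφ _ using hφ

end FundamentalTheorem

/-! ### Order of the points of contact along the boundary -/

theorem sin_smul_inner_normal (a b c : ℝ) (X : Plane) :
    Real.sin (b - a) * inner ℝ (normal c) X =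
      Real.sin (c - a) * inner ℝ (normal b) X - Real.sin (c - b) * inner ℝ (normal a) X := by
  simp only [inner_normal, Real.sin_sub]
  ring

/-- sin(φ - a) N(c) = sin(c - a) N(φ) - sin(c - φ) N(a) with nonnegative sines, and `R - A` has
nonnegative product with N(φ) and nonpositive product with N(a). -/
theorem IsSupportPoint.inner_sub_nonneg_of_lt {a φ c : ℝ} {A R : Plane}
    (hA : IsSupportPoint C a A) (hR : IsSupportPoint C φ R) (h1 : a < φ) (h2 : φ ≤ c)
    (h3 : c < a + Real.pi) : 0 ≤ inner ℝ (normal c) (R - A) := by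
  have e := sin_smul_inner_normal a φ c (R - A)
  have i1 : 0 ≤ inner ℝ (normal φ) (R - A) := by
    rw [inner_sub_right]; linarith [hR.2 A hA.1]
  have i2 : inner ℝ (normal a) (R - A) ≤ 0 := by
    rw [inner_sub_right]; linarith [hA.2 R hR.1]
  have s1 := Real.sin_pos_of_pos_of_lt_pi (x := φ - a) (by linarith) (by linarith)
  have s2 := Real.sin_nonneg_of_nonneg_of_le_pi (x := c - a) (by linarith) (by linarith)
  have s3 := Real.sin_nonneg_of_nonneg_of_le_pi (x := c - φ) (by linarith) (by linarith)
  refine nonneg_of_mul_nonneg_right ?_ s1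
  rw [e]
  linarith [mul_nonneg s2 i1, mul_nonpos_iff.2 (Or.inl ⟨s3, i2⟩)]

theorem IsSupportPoint.inner_sub_nonneg_of_gt {b φ c : ℝ} {B R : Plane}
    (hB : IsSupportPoint C b B) (hR : IsSupportPoint C φ R) (h1 : φ < b) (h2 : c ≤ φ)
    (h3 : b < c + Real.pi) : 0 ≤ inner ℝ (normal c) (R - B) := by
  have e := sin_smul_inner_normal φ b c (R - B)
  have i1 : 0 ≤ inner ℝ (normal φ) (R - B) := by
    rw [inner_sub_right]; linarith [hR.2 B hB.1]
  have i2 : inner ℝ (normal b) (R - B) ≤ 0 := by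
    rw [inner_sub_right]; linarith [hB.2 R hR.1]
  have s1 := Real.sin_pos_of_pos_of_lt_pi (x := b - φ) (by linarith) (by linarith)
  have s2 := Real.sin_nonneg_of_nonneg_of_le_pi (x := b - c) (by linarith) (by linarith)
  have s3 := Real.sin_nonneg_of_nonneg_of_le_pi (x := φ - c) (by linarith) (by linarith)
  rw [← neg_sub φ c, ← neg_sub b c, Real.sin_neg, Real.sin_neg] at e
  refine nonneg_of_mul_nonneg_right ?_ s1
  rw [e]
  linarith [mul_nonneg s2 i1, mul_nonpos_iff.2 (Or.inl ⟨s3, i2⟩)]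

theorem signedArea_eq_of_sub_eq {P Q : Plane} {r ω : ℝ} (h : Q - P = r • normal ω) (R : Plane) :
    signedArea P Q R = -(r * inner ℝ (normal (ω - Real.pi / 2)) (R - P)) := by
  have h0 : Q 0 - P 0 = r * Real.cos ω := by simpa [normal] using congrArg (fun X => X 0) h
  have h1 : Q 1 - P 1 = r * Real.sin ω := by simpa [normal] using congrArg (fun X => X 1) h
  rw [signedArea, h0, h1, inner_normal, Real.cos_sub_pi_div_two, Real.sin_sub_pi_div_two]
  simp only [PiLp.sub_apply]
  ring

theorem inner_normal_sub_pi_div_two (ω : ℝ) :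
    inner ℝ (normal (ω - Real.pi / 2)) (normal ω) = 0 := by
  rw [inner_normal, Real.cos_sub_pi_div_two, Real.sin_sub_pi_div_two]
  simp [normal]
  ring

/-- On the arc from the point of contact `A` to the point of contact `B`, the boundary of `C` is to
the right of the directed line from `A` to `B`. -/
theorem signedArea_nonpos_of_mem_Ioo {P Q A B R : Plane} {r s t ω a b φ : ℝ} (hr : 0 ≤ r)
    (hPQ : Q - P = r • normal ω) (hA : A - P = s • normal ω) (hB : B - P = t • normal ω)
    (ha : a ∈ Ioo (ω - Real.pi - Real.pi / 2) (ω - Real.pi + Real.pi / 2))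
    (hb : b ∈ Ioo (ω - Real.pi / 2) (ω + Real.pi / 2))
    (hsA : IsSupportPoint C a A) (hsB : IsSupportPoint C b B) (hsR : IsSupportPoint C φ R)
    (hφ : φ ∈ Ioo a b) : signedArea P Q R ≤ 0 := by
  rw [signedArea_eq_of_sub_eq hPQ, neg_nonpos]
  refine mul_nonneg hr ?_
  have key : ∀ X : Plane, ∀ u : ℝ, X - P = u • normal ω →
      0 ≤ inner ℝ (normal (ω - Real.pi / 2)) (R - X) →
      0 ≤ inner ℝ (normal (ω - Real.pi / 2)) (R - P) := by
    intro X u hX h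
    rw [← sub_add_sub_cancel R X P, hX, inner_add_right, inner_smul_right,
      inner_normal_sub_pi_div_two, mul_zero, add_zero]
    exact h
  rcases le_total φ (ω - Real.pi / 2) with h | h
  · exact key A s hA (hsA.inner_sub_nonneg_of_lt hsR hφ.1 h (by linarith [ha.1]))
  · exact key B t hB (hsB.inner_sub_nonneg_of_gt hsR hφ.2 h (by linarith [hb.2]))

/-! ### Chords and the support lines at their ends -/

theorem exists_normal_eq {w : Plane} (hw : ‖w‖ = 1) {ω : ℝ} (h : 0 < inner ℝ (normal ω) w) :
    ∃ β ∈ Ioo (ω - Real.pi / 2) (ω + Real.pi / 2), normal β = w := by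
  set x := (inner ℝ (normal ω) w : ℝ) with hx
  set y := (inner ℝ (tangent ω) w : ℝ) with hy
  have hcs := Real.sin_sq_add_cos_sq ω
  rw [inner_normal] at hx
  rw [inner_tangent] at hy
  have hw2 : w 0 ^ 2 + w 1 ^ 2 = 1 := by
    have := EuclideanSpace.norm_sq_eq w
    rw [hw, Fin.sum_univ_two] at this
    simpa using this.symm
  have hxy : x ^ 2 + y ^ 2 = 1 := by
    rw [hx, hy]
    linear_combination (w 0 ^ 2 + w 1 ^ 2) * hcs + hw2
  have hy1 : -1 < y := by nlinarith
  have hy2 : y < 1 := by nlinarith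
  have hcos : Real.cos (Real.arcsin y) = x := by
    rw [Real.cos_arcsin, show 1 - y ^ 2 = x ^ 2 by linarith, Real.sqrt_sq h.le]
  refine ⟨ω + Real.arcsin y, ⟨?_, ?_⟩, ?_⟩
  · linarith [Real.neg_pi_div_two_lt_arcsin.2 hy1]
  · linarith [Real.arcsin_lt_pi_div_two.2 hy2]
  · ext i
    fin_cases i
    · simp only [normal, Real.cos_add, hcos, Real.sin_arcsin hy1.le hy2.le]
      simp only [Fin.zero_eta, Matrix.cons_val_zero]
      rw [hx, hy]
      linear_combination (w 0) * hcs
    · simp only [normal, Real.sin_add, hcos, Real.sin_arcsin hy1.le hy2.le]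
      simp only [Fin.mk_one, Matrix.cons_val_one, Matrix.cons_val_zero]
      rw [hx, hy]
      linear_combination (w 1) * hcs

/-- Hahn–Banach separates `B` from the interior. The separating functional is strictly larger at `B`
than at `P`, so its direction makes an acute angle with that of the chord; this locates β within π/2
of ω. -/
theorem exists_isSupportPoint_of_notMem_interior (hc : Convex ℝ C)
    {P B : Plane} (hP : P ∈ interior C) (hB : B ∈ C) (hB' : B ∉ interior C) {t ω : ℝ}
    (ht : 0 ≤ t) (h : B - P = t • normal ω) :
    ∃ β ∈ Ioo (ω - Real.pi / 2) (ω + Real.pi / 2), IsSupportPoint C β B := by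
  obtain ⟨f, hf⟩ := geometric_hahn_banach_open_point hc.interior isOpen_interior hB'
  set v := (InnerProductSpace.toDual ℝ Plane).symm f with hv
  have hfv : ∀ X, f X = inner ℝ v X := fun X => by simp [hv]
  have hle : ∀ X ∈ C, inner ℝ v X ≤ inner ℝ v B := by
    intro X hX
    have h1 : X ∈ closure (interior C) := by
      rw [hc.closure_interior_eq_closure_of_nonempty_interior ⟨P, hP⟩]
      exact subset_closure hX
    have h2 : IsClosed {X : Plane | (inner ℝ v X : ℝ) ≤ inner ℝ v B} :=
      isClosed_le (by fun_prop) (by fun_prop)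
    refine closure_minimal (fun Y hY => ?_) h2 h1
    simpa [hfv] using (hf Y hY).le
  have hPB := hf P hP
  rw [hfv, hfv, ← sub_pos, ← inner_sub_right, h, inner_smul_right] at hPB
  have hpos := pos_of_mul_pos_right hPB ht
  have hv0 : 0 < ‖v‖ := by
    rw [norm_pos_iff]
    rintro h0
    simp [h0] at hpos
  obtain ⟨β, hβ, hn⟩ := exists_normal_eq (w := ‖v‖⁻¹ • v) (ω := ω)
    (by rw [norm_smul, norm_inv, norm_norm, inv_mul_cancel₀ hv0.ne'])
    (by rw [inner_smul_right, real_inner_comm]; positivity)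
  refine ⟨β, hβ, hB, fun X hX => ?_⟩
  rw [hn, real_inner_smul_left, real_inner_smul_left]
  exact mul_le_mul_of_nonneg_left (hle X hX) (by positivity)

/-- The parameters of the chord form a closed set bounded above, so the supremum is attained; a
parameter of an interior point can always be increased, so it is not the last. -/
theorem chordEnd_spec (hC : IsCompact C) {P Q : Plane} (hQ : Q ∈ interior C) (hPQ : P ≠ Q) :
    ∃ τ : ℝ, 1 < τ ∧ chordEnd C P Q = AffineMap.lineMap P Q τ ∧ AffineMap.lineMap P Q τ ∈ C ∧
      AffineMap.lineMap P Q τ ∉ interior C := by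
  set S := {t : ℝ | AffineMap.lineMap P Q t ∈ C} with hS
  have hcont : Continuous (fun t : ℝ => AffineMap.lineMap P Q t) :=
    AffineMap.lineMap_continuous
  have hcl : IsClosed S := hC.isClosed.preimage hcont
  have hd : 0 < dist P Q := dist_pos.2 hPQ
  have h1 : (1 : ℝ) ∈ S := by simpa [hS] using interior_subset hQ
  have hb : BddAbove S := by
    obtain ⟨M, hM⟩ := hC.isBounded.subset_closedBall P
    refine ⟨M / dist P Q, fun t ht => ?_⟩
    have h2 := hM ht
    rw [Metric.mem_closedBall, dist_lineMap_left, Real.norm_eq_abs] at h2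
    rw [le_div_iff₀ hd]
    exact (mul_le_mul_of_nonneg_right (le_abs_self t) hd.le).trans h2
  have hlt : ∀ t : ℝ, AffineMap.lineMap P Q t ∈ interior C → t < sSup S := by
    intro t ht
    have h2 : ∀ᶠ u in 𝓝 t, AffineMap.lineMap P Q u ∈ interior C :=
      hcont.continuousAt.eventually (isOpen_interior.mem_nhds ht)
    obtain ⟨u, hu, hu'⟩ := (Filter.Eventually.and
      (h2.filter_mono nhdsWithin_le_nhds) (self_mem_nhdsWithin (s := Ioi t))).exists
    exact lt_of_lt_of_le hu' (le_csSup hb (show u ∈ S from (interior_subset hu : AffineMap.lineMap P Q u ∈ C)))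
  exact ⟨sSup S, hlt 1 (by simpa using hQ), rfl, hcl.csSup_mem ⟨1, h1⟩ hb,
    fun h => lt_irrefl _ (hlt _ h)⟩

theorem hilbertDist_eq (P Q : Plane) (hPQ : P ≠ Q) {σ τ : ℝ} (hσ : 1 < σ) (hτ : 1 < τ)
    (hA : chordEnd C Q P = AffineMap.lineMap Q P σ)
    (hB : chordEnd C P Q = AffineMap.lineMap P Q τ) :
    hilbertDist C P Q = 1 / 2 * (Real.log (σ / (σ - 1)) + Real.log (τ / (τ - 1))) := by
  have hd : dist P Q ≠ 0 := dist_ne_zero.2 hPQ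
  have hd' : dist Q P ≠ 0 := dist_ne_zero.2 hPQ.symm
  rw [← Real.log_mul (div_ne_zero (by linarith) (by linarith))
    (div_ne_zero (by linarith) (by linarith))]
  simp only [hilbertDist, if_neg hPQ, hA, hB, dist_lineMap_left, dist_lineMap_right,
    Real.norm_eq_abs]
  rw [abs_of_pos (by linarith : 0 < σ), abs_of_pos (by linarith : 0 < τ),
    abs_of_neg (by linarith : 1 - σ < 0), abs_of_neg (by linarith : 1 - τ < 0), mul_div_mul_right _ _ hd, mul_div_mul_right _ _ hd', neg_sub, neg_sub]

/-! ### The Hilbert distance as an integral -/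

/-- The integral of the absolute difference over an arc on which the difference is nonpositive. -/
theorem integral_abs_cotAngle_sub (hC : IsCompact C) {P Q A B : Plane}
    (hP : P ∈ interior C) (hQ : Q ∈ interior C) {r s t ω a b : ℝ} (hr : 0 ≤ r)
    (hPQ : Q - P = r • normal ω) (hA : A - P = s • normal ω) (hB : B - P = t • normal ω)
    (ha : a ∈ Ioo (ω - Real.pi - Real.pi / 2) (ω - Real.pi + Real.pi / 2))
    (hb : b ∈ Ioo (ω - Real.pi / 2) (ω + Real.pi / 2))
    (hsA : IsSupportPoint C a A) (hsB : IsSupportPoint C b B) :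
    ∫ φ in a..b, |cotAngle C φ P - cotAngle C φ Q| =
      Real.log (height C a Q / height C a P) + Real.log (height C b P / height C b Q) := by
  have hab : a ≤ b := by linarith [ha.2, hb.1]
  have hne : C.Nonempty := ⟨P, interior_subset hP⟩
  have pos := fun X (hX : X ∈ interior C) φ => (height_pos hC hX φ).ne'
  rw [Real.log_div (pos Q hQ a) (pos P hP a), Real.log_div (pos P hP b) (pos Q hQ b),
    intervalIntegral.integral_congr_ae (g := fun φ => cotAngle C φ Q - cotAngle C φ P),
    intervalIntegral.integral_sub (intervalIntegrable_cotAngle hC hQ a b)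
      (intervalIntegrable_cotAngle hC hP a b), integral_cotAngle hC hP, integral_cotAngle hC hQ]
  · ring
  -- The sign is known only on the open arc, while the interval integral runs over `(a, b]`.
  · have hb0 : ∀ᵐ φ : ℝ, φ ≠ b := by simp [ae_iff]
    filter_upwards [ae_differentiableAt_supportFun hC hne, hb0] with φ hd hφb hφ
    rw [uIoc_of_le hab] at hφ
    obtain ⟨R, hR⟩ := exists_isSupportPoint hC hne φ
    have h := signedArea_nonpos_of_mem_Ioo hr hPQ hA hB ha hb hsA hsB hR
      ⟨hφ.1, lt_of_le_of_ne hφ.2 hφb⟩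
    rw [abs_of_nonpos, neg_sub]
    rw [hR.cotAngle_sub hC hd hP hQ]
    exact div_nonpos_of_nonpos_of_nonneg h
      (mul_pos (height_pos hC hP φ) (height_pos hC hQ φ)).le

theorem IsSupportPoint.add_two_pi {φ : ℝ} {R : Plane} (h : IsSupportPoint C φ R) :
    IsSupportPoint C (φ + 2 * Real.pi) R := by
  have e : normal (φ + 2 * Real.pi) = normal φ := by simp [normal]
  rwa [IsSupportPoint, e]

theorem exists_eq_norm_smul_normal (X : Plane) : ∃ ω, X = ‖X‖ • normal ω := by
  have hn : ‖X‖ = ‖(⟨X 0, X 1⟩ : ℂ)‖ := by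
    rw [EuclideanSpace.norm_eq, Fin.sum_univ_two, Complex.norm_eq_sqrt_sq_add_sq]
    simp
  refine ⟨Complex.arg ⟨X 0, X 1⟩, ?_⟩
  rw [hn]
  ext i
  fin_cases i
  · simp [normal, Complex.norm_mul_cos_arg]
  · simp [normal, Complex.norm_mul_sin_arg]

/-- The Hilbert distance as an integral over the support lines. -/
theorem four_mul_hilbertDist (hC : IsCompact C) (hc : Convex ℝ C) {P Q : Plane}
    (hP : P ∈ interior C) (hQ : Q ∈ interior C) :
    4 * hilbertDist C P Q =
      ∫ φ in (0 : ℝ)..(2 * Real.pi), |cotAngle C φ P - cotAngle C φ Q| := by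
  by_cases hPQ : P = Q
  · simp [hilbertDist, hPQ]
  obtain ⟨ω, hω⟩ := exists_eq_norm_smul_normal (Q - P)
  set r := ‖Q - P‖ with hr
  have hr0 : 0 ≤ r := norm_nonneg _
  have hn : ∀ θ, normal (θ - Real.pi) = -normal θ := fun θ => by
    ext i; fin_cases i <;> simp [normal]
  have hn' : ∀ θ, normal (θ + Real.pi) = -normal θ := fun θ => by
    ext i; fin_cases i <;> simp [normal]
  obtain ⟨τ, hτ, hB, hBC, hBi⟩ := chordEnd_spec hC hQ hPQ
  obtain ⟨σ, hσ, hA, hAC, hAi⟩ := chordEnd_spec hC hP (Ne.symm hPQ)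
  rw [hilbertDist_eq P Q hPQ hσ hτ hA hB]
  set A : Plane := AffineMap.lineMap Q P σ with hAdef
  set B : Plane := AffineMap.lineMap P Q τ with hBdef
  have hBP : B - P = (τ * r) • normal ω := by
    rw [hBdef, AffineMap.lineMap_apply_module', add_sub_cancel_right, hω, smul_smul]
  have hAQ : A - Q = (-(σ * r)) • normal ω := by
    rw [hAdef, AffineMap.lineMap_apply_module', add_sub_cancel_right, ← neg_sub Q P, hω,
      smul_neg, smul_smul, neg_smul]
  have hAP : A - P = (-(σ * r) + r) • normal ω := by
    rw [add_smul, ← hAQ, ← hω, sub_add_sub_cancel]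
  have hBQ : B - Q = (τ * r - r) • normal ω := by
    rw [sub_smul, ← hBP, ← hω, sub_sub_sub_cancel_right]
  obtain ⟨b, hb, hsB⟩ := exists_isSupportPoint_of_notMem_interior hc hP hBC hBi
    (by positivity) hBP
  obtain ⟨a, ha, hsA⟩ := exists_isSupportPoint_of_notMem_interior hc hQ hAC hAi
    (t := σ * r) (ω := ω - Real.pi) (by positivity) (by rw [hn, hAQ, smul_neg, neg_smul])
  have i1 := integral_abs_cotAngle_sub hC hP hQ hr0 hω hAP hBP ha hb hsA hsB
  -- The complementary arc, from `b` to `a + 2π`, is the first one with `P` and `Q` exchanged and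
  -- the direction reversed.
  have i2 := integral_abs_cotAngle_sub hC hQ hP (r := r) (s := -(τ * r - r)) (t := σ * r)
    (ω := ω + Real.pi) hr0
    (by rw [hn', smul_neg, ← hω, neg_sub]) (by rw [hn', hBQ, smul_neg, neg_smul, neg_neg])
    (by rw [hn', hAQ, smul_neg, neg_smul])
    (by rwa [add_sub_cancel_right]) (b := a + 2 * Real.pi)
    ⟨by linarith [ha.1], by linarith [ha.2]⟩ hsB hsA.add_two_pi
  have hper : ∀ X, height C (a + 2 * Real.pi) X = height C a X := fun X => height_periodic X a
  rw [hper, hper] at i2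
  simp only [abs_sub_comm (cotAngle C _ Q)] at i2
  have hint : ∀ x y, IntervalIntegrable (fun φ => |cotAngle C φ P - cotAngle C φ Q|)
      volume x y := fun x y =>
    ((intervalIntegrable_cotAngle hC hP x y).sub (intervalIntegrable_cotAngle hC hQ x y)).abs
  have hp : Function.Periodic (fun φ => |cotAngle C φ P - cotAngle C φ Q|) (2 * Real.pi) := by
    intro φ
    have h1 := cotAngle_periodic (C := C) P φ
    have h2 := cotAngle_periodic (C := C) Q φ
    simp only at h1 h2 ⊢
    rw [h1, h2]
  have i3 := hp.intervalIntegral_add_eq 0 a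
  rw [zero_add] at i3
  rw [i3, ← intervalIntegral.integral_add_adjacent_intervals (hint a b) (hint _ _), i1, i2]
  -- The height is affine along the chord and vanishes at `A`: 0 = (1 - σ) · height of `Q` + σ ·
  -- height of `P`.
  have qA : height C a Q / height C a P = σ / (σ - 1) := by
    have h := height_lineMap (C := C) a σ Q P
    rw [← hAdef, hsA.height_self] at h
    rw [div_eq_div_iff (height_pos hC hP a).ne' (by linarith)]
    linarith
  have qB : height C b P / height C b Q = τ / (τ - 1) := by
    have h := height_lineMap (C := C) b τ P Q
    rw [← hBdef, hsB.height_self] at h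
    rw [div_eq_div_iff (height_pos hC hQ b).ne' (by linarith)]
    linarith
  rw [qA, qB]
  ring

/-! ### Variation of cyclic sequences -/

theorem sum_fin_cyclic {n : ℕ} {α : Type*} (p : Fin (n + 1) → α) (f : α → α → ℝ) :
    ∑ i, f (p i) (p (i + 1)) =
      ∑ i ∈ Finset.range n, f (p (Fin.ofNat (n + 1) i)) (p (Fin.ofNat (n + 1) (i + 1))) +
        f (p (Fin.ofNat (n + 1) n)) (p (Fin.ofNat (n + 1) 0)) := by
  have h1 : ∀ i : Fin n, Fin.ofNat (n + 1) (i + 1) = i.succ := fun i => by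
    ext; simp
  rw [Fin.sum_univ_castSucc, Finset.sum_range]
  simp_rw [h1]
  simp

/-- Cyclic sequences without alternation have at most one ascent and one descent. -/
theorem sum_cyclic_abs_sub_le (n : ℕ) (a : ℕ → ℝ)
    (h : ∀ i j k l, i < j → j < k → k < l → l ≤ n →
      min (a i) (a k) ≤ max (a j) (a l) ∧ min (a j) (a l) ≤ max (a i) (a k))
    {m M : ℝ} (hm : ∀ i ≤ n, m ≤ a i) (hM : ∀ i ≤ n, a i ≤ M) :
    ∑ i ∈ Finset.range n, |a i - a (i + 1)| + |a n - a 0| ≤ 2 * (M - m) := by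
  induction n generalizing m M with
  | zero =>
    have h1 := hm 0 le_rfl
    have h2 := hM 0 le_rfl
    simp
    linarith
  | succ n ih =>
    have h' : ∀ i j k l, i < j → j < k → k < l → l ≤ n →
        min (a i) (a k) ≤ max (a j) (a l) ∧ min (a j) (a l) ≤ max (a i) (a k) :=
      fun i j k l hij hjk hkl hl => h i j k l hij hjk hkl (by omega)
    have mid : ∀ j ≤ n, j = 0 ∨ j = n ∨ (0 < j ∧ j < n) := fun j hj => by omega
    have hmn := hm (n + 1) le_rfl
    have hMn := hM (n + 1) le_rfl
    rw [Finset.sum_range_succ]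
    -- A new last term above both its neighbours `a n` and `a 0` adds twice its excess over the
    -- larger one. Non-alternation then bounds all earlier terms by that larger one, so the excess
    -- is paid for by a smaller `M`. Below both is symmetric; in between, the sum does not change.
    rcases lt_or_ge (max (a 0) (a n)) (a (n + 1)) with h1 | h1
    · have := ih h' (m := m) (M := max (a 0) (a n)) (fun i hi => hm i (by omega)) (by
        intro j hj
        rcases mid j hj with rfl | rfl | ⟨h2, h3⟩
        · exact le_max_left _ _
        · exact le_max_right _ _
        · have := (h 0 j n (n + 1) h2 h3 (by omega) le_rfl).2
          rcases min_le_iff.1 this with h4 | h4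
          · exact h4
          · exact absurd h4 (not_le.2 h1))
      grind
    rcases lt_or_ge (a (n + 1)) (min (a 0) (a n)) with h2 | h2
    · have := ih h' (m := min (a 0) (a n)) (M := M) (by
        intro j hj
        rcases mid j hj with rfl | rfl | ⟨h2', h3⟩
        · exact min_le_left _ _
        · exact min_le_right _ _
        · have := (h 0 j n (n + 1) h2' h3 (by omega) le_rfl).1
          rcases le_max_iff.1 this with h4 | h4
          · exact h4
          · exact absurd h4 (not_le.2 h2)) (fun i hi => hM i (by omega))
      grind
    have := ih h' (m := m) (M := M) (fun i hi => hm i (by omega)) (fun i hi => hM i (by omega))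
    grind

/-- Each of the two ways around the cycle from `i` to `j` contributes at least `|a i - a j|`. -/
theorem two_mul_abs_sub_le_sum_cyclic (n : ℕ) (a : ℕ → ℝ) {i j : ℕ} (hi : i ≤ n) (hj : j ≤ n) :
    2 * |a i - a j| ≤ ∑ i ∈ Finset.range n, |a i - a (i + 1)| + |a n - a 0| := by
  wlog hij : i ≤ j generalizing i j
  · rw [abs_sub_comm]
    exact this hj hi (by omega)
  have h1 := dist_le_Ico_sum_dist a (Nat.zero_le i)
  have h2 := dist_le_Ico_sum_dist a hij
  have h3 := dist_le_Ico_sum_dist a hj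
  simp only [Real.dist_eq] at h1 h2 h3
  rw [Finset.range_eq_Ico, ← Finset.sum_Ico_consecutive _ (Nat.zero_le i) hi,
    ← Finset.sum_Ico_consecutive _ hij hj]
  grind

/-! ### The cotangent along a convex polygon -/

theorem lt_cotAngle_iff {φ c : ℝ} {X : Plane} (hX : 0 < height C φ X) :
    c < cotAngle C φ X ↔
      deriv (supportFun C) φ + c * supportFun C φ < inner ℝ (tangent φ + c • normal φ) X := by
  rw [cotAngle, lt_div_iff₀ hX, height, inner_add_left, real_inner_smul_left]
  constructor <;> intro h <;> linarith

theorem cotAngle_lt_iff {φ c : ℝ} {X : Plane} (hX : 0 < height C φ X) :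
    cotAngle C φ X < c ↔
      inner ℝ (tangent φ + c • normal φ) X < deriv (supportFun C) φ + c * supportFun C φ := by
  rw [cotAngle, div_lt_iff₀ hX, height, inner_add_left, real_inner_smul_left]
  constructor <;> intro h <;> linarith

theorem cotAngle_le_iff {φ c : ℝ} {X : Plane} (hX : 0 < height C φ X) :
    cotAngle C φ X ≤ c ↔
      inner ℝ (tangent φ + c • normal φ) X ≤ deriv (supportFun C) φ + c * supportFun C φ := by
  rw [← not_lt, lt_cotAngle_iff hX, not_lt]

theorem le_cotAngle_iff {φ c : ℝ} {X : Plane} (hX : 0 < height C φ X) :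
    c ≤ cotAngle C φ X ↔
      deriv (supportFun C) φ + c * supportFun C φ ≤ inner ℝ (tangent φ + c • normal φ) X := by
  rw [← not_lt, cotAngle_lt_iff hX, not_lt]

/-- The diagonals of the convex quadrilateral XYZW cross: [YZW] X + [XYW] Z = [XZW] Y + [XYZ] W,
with positive areas and equal total weights. So no affine function is positive at one diagonal's
ends and nonpositive at the other's, and comparing the cotangent with a constant is a test on an
affine function. -/
theorem min_cotAngle_le_max (φ : ℝ) {X Y Z W : Plane}
    (hX : 0 < height C φ X) (hY : 0 < height C φ Y) (hZ : 0 < height C φ Z)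
    (hW : 0 < height C φ W) (hYZW : 0 < signedArea Y Z W) (hXYW : 0 < signedArea X Y W)
    (hXZW : 0 < signedArea X Z W) (hXYZ : 0 < signedArea X Y Z) :
    min (cotAngle C φ X) (cotAngle C φ Z) ≤ max (cotAngle C φ Y) (cotAngle C φ W) ∧
      min (cotAngle C φ Y) (cotAngle C φ W) ≤ max (cotAngle C φ X) (cotAngle C φ Z) := by
  have rel : ∀ c, signedArea Y Z W * (inner ℝ (tangent φ + c • normal φ) X -
        (deriv (supportFun C) φ + c * supportFun C φ)) +
      signedArea X Y W * (inner ℝ (tangent φ + c • normal φ) Z -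
        (deriv (supportFun C) φ + c * supportFun C φ)) =
      signedArea X Z W * (inner ℝ (tangent φ + c • normal φ) Y -
        (deriv (supportFun C) φ + c * supportFun C φ)) +
      signedArea X Y Z * (inner ℝ (tangent φ + c • normal φ) W -
        (deriv (supportFun C) φ + c * supportFun C φ)) := by
    intro c
    simp only [inner_add_left, real_inner_smul_left, inner_tangent, inner_normal, signedArea]
    ring
  constructor <;> by_contra! hlt
  · set c := max (cotAngle C φ Y) (cotAngle C φ W)
    have h1 := (lt_cotAngle_iff hX).1 (hlt.trans_le (min_le_left _ _))
    have h2 := (lt_cotAngle_iff hZ).1 (hlt.trans_le (min_le_right _ _))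
    have h3 := (cotAngle_le_iff hY).1 (show _ ≤ c from le_max_left _ _)
    have h4 := (cotAngle_le_iff hW).1 (show _ ≤ c from le_max_right _ _)
    linarith [rel c, mul_pos hYZW (sub_pos.2 h1), mul_pos hXYW (sub_pos.2 h2),
      mul_nonpos_iff.2 (Or.inl ⟨hXZW.le, sub_nonpos.2 h3⟩),
      mul_nonpos_iff.2 (Or.inl ⟨hXYZ.le, sub_nonpos.2 h4⟩)]
  · set c := max (cotAngle C φ X) (cotAngle C φ Z)
    have h1 := (lt_cotAngle_iff hY).1 (hlt.trans_le (min_le_left _ _))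
    have h2 := (lt_cotAngle_iff hW).1 (hlt.trans_le (min_le_right _ _))
    have h3 := (cotAngle_le_iff hX).1 (show _ ≤ c from le_max_left _ _)
    have h4 := (cotAngle_le_iff hZ).1 (show _ ≤ c from le_max_right _ _)
    linarith [rel c, mul_pos hXZW (sub_pos.2 h1), mul_pos hXYZ (sub_pos.2 h2),
      mul_nonpos_iff.2 (Or.inl ⟨hYZW.le, sub_nonpos.2 h3⟩),
      mul_nonpos_iff.2 (Or.inl ⟨hXYW.le, sub_nonpos.2 h4⟩)]

/-- Going once around a convex polygon, the cotangent rises and falls at most once. -/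
theorem sum_abs_cotAngle_sub_le {n : ℕ} {p : Fin (n + 1) → Plane} {φ : ℝ}
    (hp : ∀ i j k, i < j → j < k → 0 < signedArea (p i) (p j) (p k))
    (hpos : ∀ i, 0 < height C φ (p i)) {m M : ℝ} (hm : ∀ i, m ≤ cotAngle C φ (p i))
    (hM : ∀ i, cotAngle C φ (p i) ≤ M) :
    ∑ i, |cotAngle C φ (p i) - cotAngle C φ (p (i + 1))| ≤ 2 * (M - m) := by
  rw [sum_fin_cyclic p fun X Y => |cotAngle C φ X - cotAngle C φ Y|]
  refine sum_cyclic_abs_sub_le n (fun i => cotAngle C φ (p (Fin.ofNat (n + 1) i))) ?_ (fun i _ => hm _)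
    (fun i _ => hM _)
  intro i j k l hij hjk hkl hl
  have lt : ∀ s t : ℕ, s < t → t ≤ n → Fin.ofNat (n + 1) s < Fin.ofNat (n + 1) t := by
    intro s t hst ht
    rw [Fin.lt_def, Fin.val_ofNat, Fin.val_ofNat, Nat.mod_eq_of_lt (by omega),
      Nat.mod_eq_of_lt (by omega)]
    exact hst
  exact min_cotAngle_le_max φ (hpos _) (hpos _) (hpos _) (hpos _)
    (hp _ _ _ (lt j k hjk (by omega)) (lt k l hkl hl))
    (hp _ _ _ (lt i j hij (by omega)) (lt j l (by omega) hl))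
    (hp _ _ _ (lt i k (by omega) (by omega)) (lt k l hkl hl))
    (hp _ _ _ (lt i j hij (by omega)) (lt j k hjk (by omega)))

theorem two_mul_cotAngle_sub_le_sum {n : ℕ} (p : Fin (n + 1) → Plane) (φ : ℝ)
    (i j : Fin (n + 1)) :
    2 * (cotAngle C φ (p i) - cotAngle C φ (p j)) ≤
      ∑ i, |cotAngle C φ (p i) - cotAngle C φ (p (i + 1))| := by
  rw [sum_fin_cyclic p fun X Y => |cotAngle C φ X - cotAngle C φ Y|]
  have h := two_mul_abs_sub_le_sum_cyclic n (fun i => cotAngle C φ (p (Fin.ofNat (n + 1) i)))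
    (i := i) (j := j) (by omega) (by omega)
  simp only [Fin.ofNat_val_eq_self] at h
  exact (mul_le_mul_of_nonneg_left (le_abs_self _) zero_le_two).trans h

/-! ### Counterclockwise enumeration of points in convex position -/

/-- Otherwise all three barycentric coordinates of `Y` in the triangle `O X Z` would be nonnegative.
-/
theorem signedArea_pos_of_notMem_triangle {O X Y Z : Plane} (hXY : 0 < signedArea O X Y)
    (hYZ : 0 < signedArea O Y Z) (hXZ : 0 < signedArea O X Z)
    (h : Y ∉ convexHull ℝ {O, X, Z}) : 0 < signedArea X Y Z := by
  by_contra! hle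
  apply h
  set d := signedArea O X Z with hd
  have key : Y = (-signedArea X Y Z / d) • O + ((signedArea O Y Z / d) • X +
      (signedArea O X Y / d) • Z) := by
    ext i
    simp only [PiLp.add_apply, PiLp.smul_apply, smul_eq_mul]
    field_simp
    fin_cases i <;> (simp [hd, signedArea]; ring)
  have hsum : -signedArea X Y Z / d + signedArea O Y Z / d + signedArea O X Y / d = 1 := by
    field_simp
    simp only [hd, signedArea]
    ring
  rw [convexHull_insert (by simp), convexHull_pair, mem_convexJoin]
  have hs : 0 < signedArea O Y Z / d + signedArea O X Y / d := by positivity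
  set s := signedArea O Y Z / d + signedArea O X Y / d with hsdef
  refine ⟨O, rfl, (signedArea O Y Z / d / s) • X + (signedArea O X Y / d / s) • Z,
    ⟨_, _, by positivity, by positivity, by rw [← add_div, ← hsdef, div_self hs.ne'], rfl⟩,
    -signedArea X Y Z / d, s, div_nonneg (by linarith) hXZ.le, hs.le, by linarith, ?_⟩
  rw [smul_add, smul_smul, smul_smul, mul_div_cancel₀ _ hs.ne', mul_div_cancel₀ _ hs.ne', ← key]

/-- A finite set of points in convex position can be enumerated counterclockwise. -/
theorem exists_counterclockwise_enumeration (S : Finset Plane) (hne : S.Nonempty)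
    (hS : ∀ X ∈ S, X ∉ convexHull ℝ ((S : Set Plane) \ {X})) :
    ∃ (n : ℕ) (p : Fin (n + 1) → Plane), range p = S ∧
      ∀ i j k, i < j → j < k → 0 < signedArea (p i) (p j) (p k) := by
  classical
  obtain ⟨O, hO, hmax⟩ := S.exists_max_image (fun X => ‖X‖) hne
  -- Since `O` has maximal norm, every other point is seen from `O` in the open half-plane around
  -- the direction -O. Up to the factor |O|, `den` and `num` are the coordinates of `X - O` along -O
  -- and its counterclockwise normal, so `num / den` is the tangent of the polar angle and orders
  -- the points.
  set den : Plane → ℝ := fun X => O 0 * (O 0 - X 0) + O 1 * (O 1 - X 1) with hden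
  set num : Plane → ℝ := fun X => (X 0 - O 0) * O 1 - (X 1 - O 1) * O 0 with hnum
  have hden_pos : ∀ X ∈ S, X ≠ O → 0 < den X := by
    intro X hX hXO
    have h1 := pow_le_pow_left₀ (norm_nonneg _) (hmax X hX) 2
    rw [EuclideanSpace.norm_sq_eq, EuclideanSpace.norm_sq_eq, Fin.sum_univ_two,
      Fin.sum_univ_two] at h1
    simp only [Real.norm_eq_abs, sq_abs] at h1
    have h2 : 0 < ‖X - O‖ ^ 2 := pow_pos (norm_pos_iff.2 (sub_ne_zero.2 hXO)) 2
    rw [EuclideanSpace.norm_sq_eq, Fin.sum_univ_two] at h2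
    simp only [Real.norm_eq_abs, sq_abs, PiLp.sub_apply] at h2
    simp only [hden]
    nlinarith
  have hO2 : ∀ X ∈ S, X ≠ O → 0 < O 0 ^ 2 + O 1 ^ 2 := by
    intro X hX hXO
    by_contra! h
    have h0 : O 0 = 0 := by nlinarith [sq_nonneg (O 0), sq_nonneg (O 1)]
    have h1 : O 1 = 0 := by nlinarith [sq_nonneg (O 0), sq_nonneg (O 1)]
    have := hden_pos X hX hXO
    simp [hden, h0, h1] at this
  have harea : ∀ X Y, num Y * den X - num X * den Y =
      (O 0 ^ 2 + O 1 ^ 2) * signedArea O X Y := by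
    intro X Y
    simp only [hden, hnum, signedArea]
    ring
  have hlt : ∀ X ∈ S, ∀ Y ∈ S, X ≠ O → Y ≠ O → num X / den X < num Y / den Y →
      0 < signedArea O X Y := by
    intro X hX Y hY hXO hYO h
    rw [div_lt_div_iff₀ (hden_pos X hX hXO) (hden_pos Y hY hYO)] at h
    refine pos_of_mul_pos_right (a := O 0 ^ 2 + O 1 ^ 2) ?_ (hO2 X hX hXO).le
    rw [← harea]
    linarith
  -- Two points on one ray from `O` are impossible: the nearer would lie on the segment from `O` to
  -- the farther.
  have hinj : ∀ X ∈ S, ∀ Y ∈ S, X ≠ O → Y ≠ O → num X / den X = num Y / den Y →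
      den X ≤ den Y → X = Y := by
    intro X hX Y hY hXO hYO h hle
    by_contra hXY
    have dX := hden_pos X hX hXO
    have dY := hden_pos Y hY hYO
    have o2 := hO2 X hX hXO
    rw [div_eq_div_iff dX.ne' dY.ne'] at h
    have e0 : den Y * (X 0 - O 0) = den X * (Y 0 - O 0) := by
      apply mul_left_cancel₀ o2.ne'
      have : ∀ V, (O 0 ^ 2 + O 1 ^ 2) * (V 0 - O 0) = O 1 * num V - O 0 * den V := fun V => by
        simp only [hden, hnum]; ring
      linear_combination den Y * this X - den X * this Y + O 1 * h
    have e1 : den Y * (X 1 - O 1) = den X * (Y 1 - O 1) := by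
      apply mul_left_cancel₀ o2.ne'
      have : ∀ V, (O 0 ^ 2 + O 1 ^ 2) * (V 1 - O 1) = -O 0 * num V - O 1 * den V := fun V => by
        simp only [hden, hnum]; ring
      linear_combination den Y * this X - den X * this Y - O 0 * h
    apply hS X hX
    have hseg : X ∈ segment ℝ O Y := by
      refine ⟨1 - den X / den Y, den X / den Y, sub_nonneg.2 ((div_le_one dY).2 hle),
        (div_pos dX dY).le, by ring, ?_⟩
      ext i
      simp only [PiLp.add_apply, PiLp.smul_apply, smul_eq_mul]
      field_simp
      fin_cases i
      · simp only [Fin.zero_eta]; linarith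
      · simp only [Fin.mk_one]; linarith
    refine segment_subset_convexHull ?_ ?_ hseg
    · exact ⟨hO, hXO.symm⟩
    · exact ⟨hY, Ne.symm hXY⟩
  set T := S.erase O with hT
  set e := T.equivFin with he
  set f : Fin T.card → ℝ := fun i => num (e.symm i) / den (e.symm i) with hf
  set q : Fin T.card → Plane := fun i => e.symm (Tuple.sort f i) with hq
  have hqT : ∀ i, q i ∈ S ∧ q i ≠ O := fun i =>
    (Finset.mem_erase.1 (e.symm (Tuple.sort f i)).2).symm
  have hqinj : Function.Injective q := fun i j hij =>
    (Tuple.sort f).injective (e.symm.injective (Subtype.ext hij))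
  have hmono : ∀ i j, i < j → num (q i) / den (q i) < num (q j) / den (q j) := by
    intro i j hij
    refine lt_of_le_of_ne (Tuple.monotone_sort f hij.le) fun h => hij.ne (hqinj ?_)
    rcases le_total (den (q i)) (den (q j)) with h1 | h1
    · exact hinj _ (hqT i).1 _ (hqT j).1 (hqT i).2 (hqT j).2 h h1
    · exact (hinj _ (hqT j).1 _ (hqT i).1 (hqT j).2 (hqT i).2 h.symm h1).symm
  have hOq : ∀ i j, i < j → 0 < signedArea O (q i) (q j) := fun i j hij =>
    hlt _ (hqT i).1 _ (hqT j).1 (hqT i).2 (hqT j).2 (hmono i j hij)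
  refine ⟨T.card, Fin.cons O q, ?_, ?_⟩
  · rw [Fin.range_cons]
    ext X
    constructor
    · rintro (rfl | ⟨i, rfl⟩)
      · exact hO
      · exact (hqT i).1
    · intro hX
      by_cases hXO : X = O
      · exact Or.inl hXO
      · refine Or.inr ⟨(Tuple.sort f).symm (e ⟨X, Finset.mem_erase.2 ⟨hXO, hX⟩⟩), ?_⟩
        simp [hq]
  · intro i j k hij hjk
    obtain ⟨j, rfl⟩ := Fin.exists_succ_eq.2 (Fin.ne_zero_of_lt hij)
    obtain ⟨k, rfl⟩ := Fin.exists_succ_eq.2 (Fin.ne_zero_of_lt hjk)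
    have hjk' := Fin.succ_lt_succ_iff.1 hjk
    refine Fin.cases ?_ (fun i => ?_) i hij
    · intro _
      simpa using hOq j k hjk'
    · intro hij
      have hij' := Fin.succ_lt_succ_iff.1 hij
      simp only [Fin.cons_succ]
      refine signedArea_pos_of_notMem_triangle (hOq i j hij') (hOq j k hjk')
        (hOq i k (hij'.trans hjk')) fun h => hS _ (hqT j).1 (convexHull_mono ?_ h)
      rintro X (rfl | rfl | rfl)
      · exact ⟨hO, (hqT j).2.symm⟩
      · exact ⟨(hqT i).1, fun h => hij'.ne (hqinj h)⟩
      · exact ⟨(hqT k).1, fun h => hjk'.ne' (hqinj h)⟩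

/-! ### Extreme angles and extreme cotangents -/

theorem angle_mem_Ioo_and_cot_eq (hC : IsCompact C) {φ : ℝ} {R X : Plane}
    (hR : IsSupportPoint C φ R) (hX : X ∈ interior C) :
    EuclideanGeometry.angle (R + tangent φ) R X ∈ Ioo 0 Real.pi ∧
      Real.cot (EuclideanGeometry.angle (R + tangent φ) R X) =
        inner ℝ (tangent φ) (X - R) / inner ℝ (normal φ) (R - X) := by
  have hv : 0 < inner ℝ (normal φ) (R - X) := by
    rw [← hR.height_eq]
    exact height_pos hC hX φ
  have hne : X - R ≠ 0 := by
    intro h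
    rw [← neg_sub, h] at hv
    simp at hv
  have hn : 0 < ‖X - R‖ := norm_pos_iff.2 hne
  have hang : EuclideanGeometry.angle (R + tangent φ) R X =
      InnerProductGeometry.angle (tangent φ) (X - R) := by
    simp [EuclideanGeometry.angle]
  rw [hang]
  set α := InnerProductGeometry.angle (tangent φ) (X - R) with hα
  have hcos : Real.cos α = inner ℝ (tangent φ) (X - R) / ‖X - R‖ := by
    rw [hα, InnerProductGeometry.cos_angle, norm_tangent, one_mul]
  have hsin : Real.sin α = inner ℝ (normal φ) (R - X) / ‖X - R‖ := by
    have h := InnerProductGeometry.sin_angle_mul_norm_mul_norm (tangent φ) (X - R)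
    rw [norm_tangent, one_mul, real_inner_self_eq_norm_sq, norm_tangent] at h
    have h2 : inner ℝ (X - R) (X - R) = (X 0 - R 0) ^ 2 + (X 1 - R 1) ^ 2 := by
      rw [real_inner_self_eq_norm_sq, EuclideanSpace.norm_sq_eq, Fin.sum_univ_two]
      simp
    have h3 := Real.sin_sq_add_cos_sq φ
    rw [eq_div_iff hn.ne', h, h2, ← Real.sqrt_sq hv.le]
    congr 1
    simp only [inner_tangent, inner_normal, PiLp.sub_apply]
    linear_combination -((X 0 - R 0) ^ 2 + (X 1 - R 1) ^ 2) * h3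
  have hpos : 0 < Real.sin α := by rw [hsin]; positivity
  refine ⟨⟨?_, ?_⟩, ?_⟩
  · refine lt_of_le_of_ne (InnerProductGeometry.angle_nonneg _ _) fun h => ?_
    simp [← h] at hpos
  · refine lt_of_le_of_ne (InnerProductGeometry.angle_le_pi _ _) fun h => ?_
    simp [h] at hpos
  · rw [Real.cot_eq_cos_div_sin, hcos, hsin, div_div_div_cancel_right₀ hn.ne']

theorem cot_antitoneOn : AntitoneOn Real.cot (Ioo 0 Real.pi) := by
  intro a ha b hb hab
  have h1 := Real.sin_pos_of_pos_of_lt_pi ha.1 ha.2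
  have h2 := Real.sin_pos_of_pos_of_lt_pi hb.1 hb.2
  have h3 := Real.sin_nonneg_of_nonneg_of_le_pi (x := b - a) (by linarith)
    (by linarith [ha.1, hb.2])
  rw [Real.sin_sub] at h3
  rw [Real.cot_eq_cos_div_sin, Real.cot_eq_cos_div_sin, div_le_div_iff₀ h2 h1]
  linarith

/-- Where the support function is differentiable, `cot ψ₁` and `cot ψ₂` are the largest and the
smallest value of `cotAngle` on `K`. -/
theorem exists_cot_psi_eq (hC : IsCompact C) {K : Set Plane} (hK : IsCompact K)
    (hne : K.Nonempty) (hKC : K ⊆ interior C) {φ : ℝ} {R : Plane} (hR : IsSupportPoint C φ R)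
    (hd : DifferentiableAt ℝ (supportFun C) φ) :
    ∃ X₁ ∈ K, ∃ X₂ ∈ K, Real.cot (psi₁ K φ R) = cotAngle C φ X₁ ∧
      Real.cot (psi₂ K φ R) = cotAngle C φ X₂ ∧
      ∀ X ∈ K, cotAngle C φ X₂ ≤ cotAngle C φ X ∧ cotAngle C φ X ≤ cotAngle C φ X₁ := by
  have spec := fun X (hX : X ∈ K) => angle_mem_Ioo_and_cot_eq hC hR (hKC hX)
  have hcot : ∀ X ∈ K, Real.cot (EuclideanGeometry.angle (R + tangent φ) R X) =
      cotAngle C φ X := fun X hX => by rw [(spec X hX).2, hR.cotAngle_eq hC hd]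
  have hcont : ContinuousOn (fun X => EuclideanGeometry.angle (R + tangent φ) R X) K := by
    intro X hX
    have hXR : X ≠ R := by
      rintro rfl
      have := height_pos hC (hKC hX) φ
      rw [hR.height_self] at this
      exact lt_irrefl _ this
    have hT : R + tangent φ ≠ R := by
      intro h
      have h2 := norm_tangent φ
      rw [add_eq_left.1 h, norm_zero] at h2
      exact zero_ne_one h2
    have h := EuclideanGeometry.continuousAt_angle (x := (R + tangent φ, R, X)) hT hXR
    exact (h.comp (f := fun X : Plane => (R + tangent φ, R, X))
      (by fun_prop : Continuous _).continuousAt).continuousWithinAt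
  obtain ⟨X₁, h1, m1⟩ := hK.exists_isMinOn hne hcont
  obtain ⟨X₂, h2, m2⟩ := hK.exists_isMaxOn hne hcont
  refine ⟨X₁, h1, X₂, h2, ?_, ?_, fun X hX => ?_⟩
  · rw [← hcot X₁ h1]
    congr 1
    refine IsLeast.csInf_eq ⟨mem_image_of_mem _ h1, ?_⟩
    rintro _ ⟨X, hX, rfl⟩
    exact m1 hX
  · rw [← hcot X₂ h2]
    congr 1
    refine IsGreatest.csSup_eq ⟨mem_image_of_mem _ h2, ?_⟩
    rintro _ ⟨X, hX, rfl⟩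
    exact m2 hX
  · rw [← hcot X hX, ← hcot X₁ h1, ← hcot X₂ h2]
    exact ⟨cot_antitoneOn (spec X hX).1 (spec X₂ h2).1 (m2 hX),
      cot_antitoneOn (spec X₁ h1).1 (spec X hX).1 (m1 hX)⟩

/-! ### Approximation by inscribed polygons -/

/-- The constant does not depend on `φ`: denominators are at least δ on `K`, and tangential offsets
from the point of contact are at most the diameter of `C`. -/
theorem exists_dist_cotAngle_le (hC : IsCompact C) {K : Set Plane} (hK : IsCompact K)
    (hKC : K ⊆ interior C) :
    ∃ L > 0, ∀ φ, DifferentiableAt ℝ (supportFun C) φ → ∀ X ∈ K, ∀ Y ∈ K,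
      cotAngle C φ X - cotAngle C φ Y ≤ L * dist X Y := by
  obtain ⟨δ, hδ, hh⟩ := exists_le_height hC hK hKC
  set D := Metric.diam C with hD
  have hD0 : 0 ≤ D := Metric.diam_nonneg
  refine ⟨1 / δ + D / δ ^ 2, by positivity, fun φ hd X hX Y hY => ?_⟩
  have hXC := interior_subset (hKC hX)
  have hYC := interior_subset (hKC hY)
  obtain ⟨R, hR⟩ := exists_isSupportPoint hC ⟨X, hXC⟩ φ
  have vX := hh φ X hX
  have vY := hh φ Y hY
  have vX0 := hδ.trans_le vX
  have vY0 := hδ.trans_le vY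
  have hu : |inner ℝ (tangent φ) (Y - R)| ≤ D :=
    (abs_inner_tangent_le φ _).trans
      (by rw [← dist_eq_norm]; exact Metric.dist_le_diam_of_mem hC.isBounded hYC hR.1)
  have hu' : |inner ℝ (tangent φ) (X - Y)| ≤ dist X Y := by
    rw [dist_eq_norm]; exact abs_inner_tangent_le φ _
  have hv' : |inner ℝ (normal φ) (X - Y)| ≤ dist X Y := by
    rw [dist_eq_norm]; exact abs_inner_normal_le φ _
  have e : cotAngle C φ X - cotAngle C φ Y =
      inner ℝ (tangent φ) (X - Y) / height C φ X +
        inner ℝ (tangent φ) (Y - R) * inner ℝ (normal φ) (X - Y) /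
          (height C φ X * height C φ Y) := by
    have hX' := vX0.ne'
    have hY' := vY0.ne'
    rw [cotAngle, cotAngle, hR.deriv_supportFun hC hd]
    field_simp
    simp only [height, inner_sub_right]
    ring
  have t1 : inner ℝ (tangent φ) (X - Y) / height C φ X ≤ 1 / δ * dist X Y := by
    rw [one_div_mul_eq_div]
    exact div_le_div₀ dist_nonneg ((le_abs_self _).trans hu') hδ vX
  have t2 : inner ℝ (tangent φ) (Y - R) * inner ℝ (normal φ) (X - Y) /
      (height C φ X * height C φ Y) ≤ D / δ ^ 2 * dist X Y := by
    rw [div_mul_eq_mul_div, sq]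
    refine div_le_div₀ (by positivity) ((le_abs_self _).trans ?_) (by positivity)
      (mul_le_mul vX vY hδ.le vX0.le)
    rw [abs_mul]
    exact mul_le_mul hu hv' (abs_nonneg _) hD0
  rw [e, add_mul]
  exact add_le_add t1 t2

theorem exists_add_smul_mem_frontier {K : Set Plane} (hK : IsCompact K) {X d : Plane}
    (hX : X ∈ interior K) (hd : d ≠ 0) : ∃ s > (0 : ℝ), X + s • d ∈ frontier K := by
  obtain ⟨τ, hτ, -, h1, h2⟩ := chordEnd_spec hK (P := X - d) hX
    (by rwa [Ne, sub_eq_self])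
  have e : AffineMap.lineMap (X - d) X τ = X + (τ - 1) • d := by
    rw [AffineMap.lineMap_apply_module', sub_sub_cancel, sub_smul, one_smul]
    abel
  rw [e] at h1 h2
  exact ⟨τ - 1, by linarith, subset_closure h1, h2⟩

theorem inner_tangent_add_smul_normal_self (φ c : ℝ) :
    inner ℝ (tangent φ + c • normal φ) (tangent φ + c • normal φ) = 1 + c ^ 2 := by
  have h := Real.sin_sq_add_cos_sq φ
  simp only [inner_add_left, real_inner_smul_left, inner_tangent, inner_normal]
  simp only [PiLp.add_apply, PiLp.smul_apply, smul_eq_mul, tangent, normal]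
  simp
  linear_combination (1 + c ^ 2) * h

/-- The extreme values of `cotAngle` on `K` are attained on the frontier. -/
theorem exists_mem_frontier_cotAngle_le (hC : IsCompact C) {K : Set Plane} (hK : IsCompact K)
    (hKC : K ⊆ interior C) (φ : ℝ) {X : Plane} (hX : X ∈ K) :
    (∃ Y ∈ frontier K, cotAngle C φ X ≤ cotAngle C φ Y) ∧
      ∃ Y ∈ frontier K, cotAngle C φ Y ≤ cotAngle C φ X := by
  by_cases hXi : X ∈ interior K
  swap
  · exact ⟨⟨X, ⟨subset_closure hX, hXi⟩, le_rfl⟩, ⟨X, ⟨subset_closure hX, hXi⟩, le_rfl⟩⟩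
  have pos : ∀ Y ∈ frontier K, 0 < height C φ Y := fun Y hY =>
    height_pos hC (hKC (hK.isClosed.frontier_subset hY)) φ
  have hX0 := height_pos hC (hKC hX) φ
  set c := cotAngle C φ X with hc
  -- The cotangent is at least `c` exactly where `⟪d, ·⟫` reaches its value at `X`; walking from `X`
  -- along ±d to the frontier therefore goes to the correct side.
  set d := tangent φ + c • normal φ with hd
  have hdd := inner_tangent_add_smul_normal_self φ c
  rw [← hd] at hdd
  have hd0 : d ≠ 0 := by
    rintro h
    rw [h, inner_zero_left] at hdd
    nlinarith [sq_nonneg c]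
  have e1 := (cotAngle_le_iff hX0).1 hc.ge
  have e2 := (le_cotAngle_iff hX0).1 hc.le
  rw [← hd] at e1 e2
  constructor
  · obtain ⟨s, hs, hY⟩ := exists_add_smul_mem_frontier hK hXi hd0
    refine ⟨_, hY, (le_cotAngle_iff (pos _ hY)).2 ?_⟩
    rw [← hd, inner_add_right, inner_smul_right, hdd]
    nlinarith [sq_nonneg c]
  · obtain ⟨s, hs, hY⟩ := exists_add_smul_mem_frontier hK hXi (neg_ne_zero.2 hd0)
    refine ⟨_, hY, (cotAngle_le_iff (pos _ hY)).2 ?_⟩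
    rw [← hd, inner_add_right, inner_smul_right, inner_neg_right, hdd]
    nlinarith [sq_nonneg c]

/-- The extreme values of `cotAngle` on a finite set are attained at extreme points of its convex
hull. -/
theorem exists_mem_extremePoints_cotAngle_le {S : Set Plane} (hS : S.Finite) (φ : ℝ)
    (hpos : ∀ X ∈ S, 0 < height C φ X) {X : Plane} (hX : X ∈ S) :
    (∃ Y ∈ (convexHull ℝ S).extremePoints ℝ, cotAngle C φ X ≤ cotAngle C φ Y) ∧
      ∃ Y ∈ (convexHull ℝ S).extremePoints ℝ, cotAngle C φ Y ≤ cotAngle C φ X := by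
  set E := (convexHull ℝ S).extremePoints ℝ with hE
  have hES : E ⊆ S := extremePoints_convexHull_subset
  have hhull : X ∈ convexHull ℝ E := by
    have h := closure_convexHull_extremePoints (hS.isCompact_convexHull ℝ) (convex_convexHull ℝ S)
    rw [((hS.subset hES).isClosed_convexHull ℝ).closure_eq] at h
    rw [h]
    exact subset_convexHull ℝ S hX
  set c := cotAngle C φ X with hc
  set d := tangent φ + c • normal φ with hd
  have hlin : IsLinearMap ℝ (fun Y : Plane => (inner ℝ d Y : ℝ)) :=
    ⟨fun _ _ => inner_add_right _ _ _, fun _ _ => inner_smul_right _ _ _⟩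
  constructor
  · by_contra! h
    have h1 : E ⊆ {Y | inner ℝ d Y < deriv (supportFun C) φ + c * supportFun C φ} :=
      fun Y hY => (cotAngle_lt_iff (hpos Y (hES hY))).1 (h Y hY)
    have h2 := convexHull_min h1 (convex_halfSpace_lt hlin _) hhull
    exact lt_irrefl _ ((cotAngle_lt_iff (hpos X hX)).2 h2)
  · by_contra! h
    have h1 : E ⊆ {Y | deriv (supportFun C) φ + c * supportFun C φ < inner ℝ d Y} :=
      fun Y hY => (lt_cotAngle_iff (hpos Y (hES hY))).1 (h Y hY)
    have h2 := convexHull_min h1 (convex_halfSpace_gt hlin _) hhull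
    exact lt_irrefl _ ((lt_cotAngle_iff (hpos X hX)).2 h2)

/-- Inscribed polygons approximate `K` uniformly in direction. -/
theorem exists_isInscribedPolygon_approx (hC : IsCompact C) {K : Set Plane} (hK : IsCompact K)
    (hne : K.Nonempty) (hKC : K ⊆ interior C) {ε : ℝ} (hε : 0 < ε) :
    ∃ (n : ℕ) (p : Fin (n + 1) → Plane), IsInscribedPolygon K p ∧
      ∀ φ, DifferentiableAt ℝ (supportFun C) φ → ∀ X ∈ K,
        (∃ i, cotAngle C φ X ≤ cotAngle C φ (p i) + ε) ∧
          ∃ i, cotAngle C φ (p i) ≤ cotAngle C φ X + ε := by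
  obtain ⟨L, hL, hLip⟩ := exists_dist_cotAngle_le hC hK hKC
  have hfr : IsCompact (frontier K) := hK.of_isClosed_subset isClosed_frontier
    hK.isClosed.frontier_subset
  obtain ⟨S, hSfr, hS, hcov⟩ := hfr.finite_cover_balls (div_pos hε hL)
  have hSK : S ⊆ K := hSfr.trans hK.isClosed.frontier_subset
  -- Passing from the net to its extreme points gives strictly convex position without changing the
  -- extreme cotangents.
  set E := (convexHull ℝ S).extremePoints ℝ with hE
  have hES : E ⊆ S := extremePoints_convexHull_subset
  have hEfin : E.Finite := hS.subset hES
  have net : ∀ Y ∈ frontier K, ∃ Z ∈ S, dist Y Z < ε / L := fun Y hY => by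
    simpa using hcov hY
  have hpos : ∀ φ, ∀ X ∈ S, 0 < height C φ X := fun φ X hX => height_pos hC (hKC (hSK hX)) φ
  have hEne : E.Nonempty := by
    obtain ⟨X, hX⟩ := hne
    obtain ⟨⟨Y, hY, -⟩, -⟩ := exists_mem_frontier_cotAngle_le hC hK hKC 0 hX
    obtain ⟨Z, hZ, -⟩ := net Y hY
    obtain ⟨⟨V, hV, -⟩, -⟩ := exists_mem_extremePoints_cotAngle_le hS 0 (hpos 0) hZ
    exact ⟨V, hV⟩
  have hind : ∀ X ∈ E, X ∉ convexHull ℝ (E \ {X}) :=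
    convexIndependent_set_iff_notMem_convexHull_sdiff.1
      (convex_convexHull ℝ S).convexIndependent_extremePoints
  obtain ⟨n, p, hp, hccw⟩ := exists_counterclockwise_enumeration hEfin.toFinset
    (by simpa using hEne) (by simpa using hind)
  rw [hEfin.coe_toFinset] at hp
  refine ⟨n, p, ⟨fun i => hSfr (hES (hp ▸ mem_range_self i)), hccw⟩, fun φ hd X hX => ?_⟩
  have hKfr := hK.isClosed.frontier_subset
  have small : ∀ Y Z : Plane, dist Y Z < ε / L → L * dist Y Z ≤ ε := fun Y Z h => by
    rw [lt_div_iff₀ hL] at h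
    linarith
  obtain ⟨⟨Y, hY, hXY⟩, ⟨Y', hY', hXY'⟩⟩ := exists_mem_frontier_cotAngle_le hC hK hKC φ hX
  constructor
  · obtain ⟨Z, hZ, hYZ⟩ := net Y hY
    obtain ⟨⟨V, hV, hZV⟩, -⟩ := exists_mem_extremePoints_cotAngle_le hS φ (hpos φ) hZ
    obtain ⟨i, rfl⟩ : V ∈ range p := hp ▸ hV
    refine ⟨i, ?_⟩
    linarith [hLip φ hd Y (hKfr hY) Z (hSK hZ), small _ _ hYZ]
  · obtain ⟨Z, hZ, hYZ⟩ := net Y' hY'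
    obtain ⟨-, ⟨V, hV, hZV⟩⟩ := exists_mem_extremePoints_cotAngle_le hS φ (hpos φ) hZ
    obtain ⟨i, rfl⟩ : V ∈ range p := hp ▸ hV
    refine ⟨i, ?_⟩
    have h := hLip φ hd Z (hSK hZ) Y' (hKfr hY')
    rw [dist_comm] at h
    linarith [small _ _ hYZ]

/-! ### Perimeter as an integral -/

theorem intervalIntegrable_abs_cotAngle_sub (hC : IsCompact C) {P Q : Plane}
    (hP : P ∈ interior C) (hQ : Q ∈ interior C) (a b : ℝ) :
    IntervalIntegrable (fun φ => |cotAngle C φ P - cotAngle C φ Q|) volume a b :=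
  ((intervalIntegrable_cotAngle hC hP a b).sub (intervalIntegrable_cotAngle hC hQ a b)).abs

theorem intervalIntegrable_sum_abs_cotAngle_sub (hC : IsCompact C) {n : ℕ}
    {p : Fin (n + 1) → Plane} (hp : ∀ i, p i ∈ interior C) (a b : ℝ) :
    IntervalIntegrable (fun φ => ∑ i, |cotAngle C φ (p i) - cotAngle C φ (p (i + 1))|)
      volume a b := by
  have h := IntervalIntegrable.sum (μ := volume) (a := a) (b := b) Finset.univ
    (f := fun i φ => |cotAngle C φ (p i) - cotAngle C φ (p (i + 1))|)
    fun i _ => intervalIntegrable_abs_cotAngle_sub hC (hp i) (hp (i + 1)) a b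
  simpa only [Finset.sum_fn] using h

theorem four_mul_polygonLength (hC : IsCompact C) (hc : Convex ℝ C) {n : ℕ}
    {p : Fin (n + 1) → Plane} (hp : ∀ i, p i ∈ interior C) :
    4 * polygonLength C p = ∫ φ in (0 : ℝ)..(2 * Real.pi),
      ∑ i, |cotAngle C φ (p i) - cotAngle C φ (p (i + 1))| := by
  rw [intervalIntegral.integral_finsetSum fun i _ =>
    intervalIntegrable_abs_cotAngle_sub hC (hp i) (hp (i + 1)) _ _, polygonLength, Finset.mul_sum]
  exact Finset.sum_congr rfl fun i _ => four_mul_hilbertDist hC hc (hp i) (hp (i + 1))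

/-- If `W` is almost everywhere the oscillation of `cotAngle` on `K`, then it is integrable and the
Hilbert perimeter of `K` is half its integral. -/
theorem intervalIntegrable_and_hilbertPerimeter_eq (hC : IsCompact C) (hc : Convex ℝ C)
    {K : Set Plane} (hK : IsCompact K) (hne : K.Nonempty) (hKC : K ⊆ interior C) {W : ℝ → ℝ}
    (hW : ∀ᵐ φ, φ ∈ Ioc 0 (2 * Real.pi) → ∃ X₁ ∈ K, ∃ X₂ ∈ K,
      W φ = cotAngle C φ X₁ - cotAngle C φ X₂ ∧
      ∀ X ∈ K, cotAngle C φ X₂ ≤ cotAngle C φ X ∧ cotAngle C φ X ≤ cotAngle C φ X₁) :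
    IntervalIntegrable W volume 0 (2 * Real.pi) ∧
      hilbertPerimeter C K = ((1 / 2 * ∫ φ in (0 : ℝ)..(2 * Real.pi), W φ : ℝ) : EReal) := by
  have hpi : (0 : ℝ) ≤ 2 * Real.pi := by positivity
  have hCne : C.Nonempty := hne.mono (hKC.trans interior_subset)
  have hsub : ∀ {n : ℕ} {p : Fin (n + 1) → Plane}, IsInscribedPolygon K p →
      ∀ i, p i ∈ K := fun hp i => hK.isClosed.frontier_subset (hp.1 i)
  have upper : ∀ {n : ℕ} {p : Fin (n + 1) → Plane}, IsInscribedPolygon K p →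
      ∀ᵐ φ, φ ∈ Ioc 0 (2 * Real.pi) →
        ∑ i, |cotAngle C φ (p i) - cotAngle C φ (p (i + 1))| ≤ 2 * W φ := by
    intro n p hp
    filter_upwards [hW] with φ h hφ
    obtain ⟨X₁, -, X₂, -, hWφ, hX⟩ := h hφ
    rw [hWφ]
    exact sum_abs_cotAngle_sub_le hp.2 (fun i => height_pos hC (hKC (hsub hp i)) φ)
      (fun i => (hX _ (hsub hp i)).1) fun i => (hX _ (hsub hp i)).2
  -- Each of the two extreme values is missed by at most ε, and the oscillation is counted twice,
  -- hence 4ε.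
  have lower : ∀ ε > 0, ∃ (n : ℕ) (p : Fin (n + 1) → Plane), IsInscribedPolygon K p ∧
      ∀ᵐ φ, φ ∈ Ioc 0 (2 * Real.pi) →
        2 * W φ ≤ (∑ i, |cotAngle C φ (p i) - cotAngle C φ (p (i + 1))|) + 4 * ε := by
    intro ε hε
    obtain ⟨n, p, hp, h⟩ := exists_isInscribedPolygon_approx hC hK hne hKC hε
    refine ⟨n, p, hp, ?_⟩
    filter_upwards [hW, ae_differentiableAt_supportFun hC hCne] with φ hWφ hd hφ
    obtain ⟨X₁, h1, X₂, h2, hWφ, -⟩ := hWφ hφ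
    obtain ⟨i, hi⟩ := (h φ hd X₁ h1).1
    obtain ⟨j, hj⟩ := (h φ hd X₂ h2).2
    linarith [two_mul_cotAngle_sub_le_sum (C := C) p φ i j]
  -- `W` involves arbitrary points of contact; it is measurable as the almost everywhere limit of
  -- half the polygon sums.
  have meas : AEStronglyMeasurable W (volume.restrict (Ioc 0 (2 * Real.pi))) := by
    have hε : ∀ k : ℕ, (0 : ℝ) < 1 / ((k : ℝ) + 1) := fun k => by positivity
    choose n p hp hlow using fun k => lower _ (hε k)
    have hint := fun k => intervalIntegrable_sum_abs_cotAngle_sub hC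
      (fun i => hKC (hsub (hp k) i)) 0 (2 * Real.pi)
    refine aestronglyMeasurable_of_tendsto_ae atTop
      (f := fun k φ => 1 / 2 * ∑ i, |cotAngle C φ (p k i) - cotAngle C φ (p k (i + 1))|)
      (fun k => ((hint k).const_mul _).1.aestronglyMeasurable) ?_
    rw [ae_restrict_iff' measurableSet_Ioc]
    filter_upwards [ae_all_iff.2 hlow, ae_all_iff.2 fun k => upper (hp k)] with φ h1 h2 hφ
    have h3 : Tendsto (fun k : ℕ => W φ - 2 * (1 / ((k : ℝ) + 1))) atTop (𝓝 (W φ)) := by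
      simpa using (tendsto_one_div_add_atTop_nhds_zero_nat (𝕜 := ℝ)).const_mul 2 |>.const_sub (W φ)
    refine tendsto_of_tendsto_of_tendsto_of_le_of_le h3 tendsto_const_nhds (fun k => ?_)
      fun k => ?_
    · have := h1 k hφ
      simp only
      linarith
    · have := h2 k hφ
      simp only
      linarith
  have integrable : IntervalIntegrable W volume 0 (2 * Real.pi) := by
    obtain ⟨n, p, hp, hlow⟩ := lower 1 one_pos
    have hint := intervalIntegrable_sum_abs_cotAngle_sub hC
      (fun i => hKC (hsub hp i)) 0 (2 * Real.pi)
    have hbound := (hint.add (intervalIntegrable_const (c := (4 : ℝ)))).1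
    rw [intervalIntegrable_iff_integrableOn_Ioc_of_le hpi]
    refine Integrable.mono' hbound meas ?_
    rw [ae_restrict_iff' measurableSet_Ioc]
    filter_upwards [hlow, upper hp] with φ h1 h2 hφ
    have hnn : 0 ≤ ∑ i, |cotAngle C φ (p i) - cotAngle C φ (p (i + 1))| :=
      Finset.sum_nonneg fun _ _ => abs_nonneg _
    have h1 := h1 hφ
    have h2 := h2 hφ
    rw [Real.norm_eq_abs, abs_of_nonneg (by linarith)]
    linarith
  have integral_le : ∀ {f g : ℝ → ℝ}, IntervalIntegrable f volume 0 (2 * Real.pi) →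
      IntervalIntegrable g volume 0 (2 * Real.pi) →
      (∀ᵐ φ, φ ∈ Ioc 0 (2 * Real.pi) → f φ ≤ g φ) →
      ∫ φ in (0 : ℝ)..(2 * Real.pi), f φ ≤ ∫ φ in (0 : ℝ)..(2 * Real.pi), g φ := by
    intro f g hf hg h
    rw [intervalIntegral.integral_of_le hpi, intervalIntegral.integral_of_le hpi]
    exact setIntegral_mono_ae_restrict hf.1 hg.1 ((ae_restrict_iff' measurableSet_Ioc).2 h)
  refine ⟨integrable, le_antisymm ?_ ?_⟩
  · refine iSup_le fun n => iSup_le fun p => iSup_le fun hp => EReal.coe_le_coe_iff.2 ?_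
    have h := integral_le (intervalIntegrable_sum_abs_cotAngle_sub hC
      (fun i => hKC (hsub hp i)) 0 (2 * Real.pi)) (integrable.const_mul 2) (upper hp)
    rw [← four_mul_polygonLength hC hc fun i => hKC (hsub hp i),
      intervalIntegral.integral_const_mul] at h
    linarith
  · refine EReal.ge_of_forall_gt_iff_ge.1 fun z hz => ?_
    rw [EReal.coe_lt_coe_iff] at hz
    set I := ∫ φ in (0 : ℝ)..(2 * Real.pi), W φ with hI
    -- With this ε the error 4ε, integrated over the period, is 4(I/2 - z), which leaves exactly `z
    -- ≤ polygonLength C p`.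
    obtain ⟨n, p, hp, hlow⟩ := lower ((1 / 2 * I - z) / (2 * Real.pi))
      (div_pos (by linarith) (by positivity))
    have hint := intervalIntegrable_sum_abs_cotAngle_sub hC
      (fun i => hKC (hsub hp i)) 0 (2 * Real.pi)
    have h := integral_le (integrable.const_mul 2) (hint.add intervalIntegrable_const) hlow
    rw [intervalIntegral.integral_const_mul, intervalIntegral.integral_add hint
      intervalIntegrable_const, ← four_mul_polygonLength hC hc fun i => hKC (hsub hp i),
      intervalIntegral.integral_const, smul_eq_mul, sub_zero] at h
    have e : 2 * Real.pi * (4 * ((1 / 2 * I - z) / (2 * Real.pi))) = 4 * (1 / 2 * I - z) := by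
      field_simp
    rw [e] at h
    refine le_trans (EReal.coe_le_coe_iff.2 (?_ : z ≤ polygonLength C p))
      (le_iSup_of_le n (le_iSup_of_le p (le_iSup_of_le hp le_rfl)))
    linarith

end HilbertPlane

end

theorem theorem3p2 (C K : ConvexBody HilbertPlane.Plane)
    (hK : (K : Set HilbertPlane.Plane) ⊆ interior (C : Set HilbertPlane.Plane))
    (R : ℝ → HilbertPlane.Plane)
    (hR : ∀ φ ∈ Set.Icc 0 (2 * Real.pi), HilbertPlane.IsSupportPoint C φ (R φ)) :
    IntervalIntegrable
        (fun φ => Real.cot (HilbertPlane.psi₁ K φ (R φ)) - Real.cot (HilbertPlane.psi₂ K φ (R φ)))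
        MeasureTheory.volume 0 (2 * Real.pi) ∧
      HilbertPlane.hilbertPerimeter C K =
        ((1 / 2 * ∫ φ in (0 : ℝ)..(2 * Real.pi),
          (Real.cot (HilbertPlane.psi₁ K φ (R φ)) - Real.cot (HilbertPlane.psi₂ K φ (R φ))) : ℝ) :
          EReal) := by
  refine HilbertPlane.intervalIntegrable_and_hilbertPerimeter_eq C.isCompact C.convex K.isCompact
    K.nonempty hK ?_
  filter_upwards [HilbertPlane.ae_differentiableAt_supportFun C.isCompact C.nonempty] with φ hd hφ
  obtain ⟨X₁, h1, X₂, h2, e1, e2, h⟩ := HilbertPlane.exists_cot_psi_eq C.isCompact K.isCompact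
    K.nonempty hK (hR φ (Set.Ioc_subset_Icc_self hφ)) hd
  exact ⟨X₁, h1, X₂, h2, by rw [e1, e2], h⟩
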